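/- A \emph{valued differential field} is a field $K$ of characteristic $0$ with a derivation $\partial$ (written $a'=\partial a$) and a valuation $v\colon K\to\Gamma\cup\{\infty\}$ with value group $\Gamma=v(K^\times)$ whose valuation ring $\mathcal O$ contains $\mathbb Q$; $\mathfrak o=\{f: v(f)>0\}$ is the maximal ideal. Write $f\preccurlyeq g$, $f\prec g$, $f\asymp g$ for $v(f)\ge v(g)$, $v(f)>v(g)$, $v(f)=v(g)$, and $f^\dagger=f'/f$ for $f\neq0$. It is an \emph{asymptotic field} if for all $f,g\in K^\times$ with $f,g\prec1$: $f\prec g\iff f'\prec g'$; then $\psi\colon\Gamma\setminus\{0\}\to\Gamma$, $\psi(v(g))=v(g^\dagger)$, is well defined. Put $\Psi=\psi(\Gamma\setminus\{0\})$ and $(\Gamma^>)'=\{\gamma+\psi(\gamma):\gamma\in\Gamma,\ \gamma>0\}$. An asymptotic field $K$ is \emph{of $H$-type} (or \emph{$H$-asymptotic}) if $0<\alpha\le\beta$ implies $\psi(\alpha)\ge\psi(\beta)$, and \emph{pre-$\mathrm d$-valued} if $f'\prec g^\dagger$ for all $f,g\in K^\times$ with $f\preccurlyeq1$, $g\prec1$.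 An $H$-asymptotic field $K$ is \emph{$\lambda$-free} if $\Gamma\ne\{0\}$, $\Psi$ has no largest element, and for every $a\in K$ there is $g\in K$ with $g\succ1$ and $a-g^{\dagger\dagger}\succcurlyeq g^\dagger$. \textbf{Proposition.} Let $K$ be a henselian pre-$\mathrm d$-valued field of $H$-type and let $s\in K$ be such that $v(s)\in(\Gamma^>)'$ and $s\notin\partial\mathfrak o$. Let $L=K(y)$ be a field extension of $K$ with $y$ transcendental over $K$, equipped with the derivation extending that of $K$ with $y'=s$, and equipped with a valuation making $L$ an $H$-asymptotic extension of $K$ with $y\not\asymp1$. If $K$ is $\lambda$-free, then so is $L$. -/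

import Mathlib

open scoped Differential

/-! Asymptotic couples and valued differential fields. Valuations are written additively, as
surjections `v : K → Γ ∪ {∞}` onto the value group with `∞` adjoined; thus `f ≼ g` means
`v g ≤ v f`, `f ≺ g` means `v g < v f`, `f ≍ g` means `v f = v g`, and the valuation ring is
`{f | 0 ≤ v f}`. -/

section AsymptoticCouples

variable {Γ : Type*} [AddCommGroup Γ] [LinearOrder Γ]

/-- The axioms (AC1), (AC2), (AC3) of an asymptotic couple `(Γ, ψ)`. Only the values of `ψ` at
nonzero elements matter. -/
structure IsAsymptoticCouple (ψ : Γ → Γ) : Prop where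
  ac1 : ∀ α β : Γ, α ≠ 0 → β ≠ 0 → α + β ≠ 0 → min (ψ α) (ψ β) ≤ ψ (α + β)
  ac2 : ∀ (k : ℤ) (α : Γ), k ≠ 0 → α ≠ 0 → ψ (k • α) = ψ α
  ac3 : ∀ α β : Γ, 0 < α → β ≠ 0 → ψ β < α + ψ α

/-- The condition (HC): the asymptotic couple `(Γ, ψ)` is of `H`-type. -/
def IsHTypeCouple (ψ : Γ → Γ) : Prop :=
  ∀ α β : Γ, 0 < α → α ≤ β → ψ β ≤ ψ α

/-- The set `Ψ = {ψ(γ) : γ ≠ 0}`. -/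
def psiSet (ψ : Γ → Γ) : Set Γ :=
  {δ | ∃ γ : Γ, γ ≠ 0 ∧ ψ γ = δ}

/-- The set `(Γ^>)' = {γ + ψ(γ) : γ > 0}`. -/
def derivPosSet (ψ : Γ → Γ) : Set Γ :=
  {δ | ∃ γ : Γ, 0 < γ ∧ γ + ψ γ = δ}

/-- `(Γ, ψ)` is grounded if `Ψ` has a largest element. -/
def IsGroundedCouple (ψ : Γ → Γ) : Prop :=
  ∃ γ : Γ, IsGreatest (psiSet ψ) γ

end AsymptoticCouples

section ValuedDifferentialFields

variable {K : Type*} [Field K] [Differential K]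
variable {Γ : Type*} [AddCommGroup Γ] [LinearOrder Γ] [IsOrderedAddMonoid Γ]

/-- `K` is a valued differential field with value group `Γ`: a differential field of characteristic
zero with a valuation whose valuation ring contains `ℚ`. -/
structure IsValuedDifferentialField (v : AddValuation K (WithTop Γ)) : Prop where
  charZero : CharZero K
  surjective : Function.Surjective v
  rat_mem : ∀ q : ℚ, 0 ≤ v (q : K)

/-- An asymptotic field: `f ≺ g ↔ f' ≺ g'` for all nonzero `f, g ≺ 1`. -/
structure IsAsymptoticField (v : AddValuation K (WithTop Γ)) : Prop
    extends IsValuedDifferentialField v where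
  asymp : ∀ f g : K, f ≠ 0 → g ≠ 0 → 0 < v f → 0 < v g → (v g < v f ↔ v (g′) < v (f′))

/-- A pre-differential-valued field: an asymptotic field with `f' ≺ g†` for all nonzero `f ≼ 1`
and `g ≺ 1`. -/
structure IsPreDValued (v : AddValuation K (WithTop Γ)) : Prop extends IsAsymptoticField v where
  pdv : ∀ f g : K, f ≠ 0 → g ≠ 0 → 0 ≤ v f → 0 < v g → v (Differential.logDeriv g) < v (f′)

/-- The map `ψ` of the asymptotic couple `(Γ, ψ)` of an asymptotic field: for `γ ≠ 0`, `ψ γ` is the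
element `δ` of `Γ` with `v (g†) = δ` for all `g` with `v g = γ` (see `coe_fieldPsi` below).
The value at `0` carries no information. -/
noncomputable def fieldPsi (v : AddValuation K (WithTop Γ)) (γ : Γ) : Γ :=
  Classical.epsilon fun δ : Γ => ∀ g : K, v g = (γ : WithTop Γ) →
    v (Differential.logDeriv g) = (δ : WithTop Γ)

/-- An asymptotic field is `H`-asymptotic, or of `H`-type, if its asymptotic couple is. -/
structure IsHAsymptotic (v : AddValuation K (WithTop Γ)) : Prop extends IsAsymptoticField v where
  hType : IsHTypeCouple (fieldPsi v)

/-- `λ`-freeness of an `H`-asymptotic field: it is ungrounded, its value group is not `{0}`, and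
for all `s` there is `g ≻ 1` such that `s - g†† ≽ g†`. -/
structure IsLambdaFree (v : AddValuation K (WithTop Γ)) : Prop where
  ungrounded : ¬ IsGroundedCouple (fieldPsi v)
  nontrivial : Nontrivial Γ
  exists_ge : ∀ s : K, ∃ g : K, v g < 0 ∧
    v (s - Differential.logDeriv (Differential.logDeriv g)) ≤ v (Differential.logDeriv g)

/-- The valuation ring of `v` is henselian. -/
def IsHenselianValued (v : AddValuation K (WithTop Γ)) : Prop :=
  HenselianLocalRing (AddValuation.toValuation v).valuationSubring

section Sanity

variable {v : AddValuation K (WithTop Γ)}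

lemma logDeriv_inv_aux {g : K} (hg : g ≠ 0) :
    Differential.logDeriv g⁻¹ = -Differential.logDeriv g := by
  have := Differential.logDeriv_div (1 : K) g one_ne_zero hg
  simpa using this

lemma IsAsymptoticField.deriv_ne_zero (h : IsAsymptoticField v) {g : K} (hg : g ≠ 0)
    (hv : 0 < v g) : g′ ≠ 0 := by
  have h0 : v g ≠ ⊤ := v.ne_top_iff.2 hg
  have h2 : v g < v (g * g) := by
    rw [v.map_mul]
    lift v g to Γ using h0 with a
    norm_cast at hv ⊢
    exact lt_add_of_pos_left a hv
  have h3 := (h.asymp (g * g) g (mul_ne_zero hg hg) hg (hv.trans h2) hv).1 h2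
  intro h4
  rw [h4, v.map_zero] at h3
  exact not_top_lt h3

lemma IsAsymptoticField.val_logDeriv_eq (h : IsAsymptoticField v) {f g : K} (hg : g ≠ 0)
    (hv : v g ≠ 0) (hfg : v f = v g) :
    v (Differential.logDeriv f) = v (Differential.logDeriv g) := by
  have key : ∀ f g : K, f ≠ 0 → g ≠ 0 → 0 < v g → v f = v g →
      v (Differential.logDeriv f) = v (Differential.logDeriv g) := by
    intro f g hf hg hv hfg
    have h1 : v (f′) = v (g′) := by
      apply le_antisymm
      · exact not_lt.1 fun h' => ((h.asymp f g hf hg (hfg ▸ hv) hv).2 h').ne hfg.symm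
      · exact not_lt.1 fun h' => ((h.asymp g f hg hf hv (hfg ▸ hv)).2 h').ne hfg
    simp [Differential.logDeriv, div_eq_mul_inv, h1, hfg]
  have hf : f ≠ 0 := by
    rw [← v.ne_top_iff, hfg]
    exact v.ne_top_iff.2 hg
  rcases lt_or_gt_of_ne hv with hneg | hpos
  · have hinv : 0 < v g⁻¹ := by
      rw [v.map_inv]
      have h0 : v g ≠ ⊤ := v.ne_top_iff.2 hg
      lift v g to Γ using h0 with a
      norm_cast at hneg ⊢
      exact neg_pos.2 hneg
    have := key f⁻¹ g⁻¹ (inv_ne_zero hf) (inv_ne_zero hg) hinv (by simp [hfg])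
    simpa [logDeriv_inv_aux hf, logDeriv_inv_aux hg] using this
  · exact key f g hf hg hpos hfg

lemma IsAsymptoticField.val_logDeriv_ne_top (h : IsAsymptoticField v) {g : K} (hg : g ≠ 0)
    (hv : v g ≠ 0) : v (Differential.logDeriv g) ≠ ⊤ := by
  rw [v.ne_top_iff]
  rcases lt_or_gt_of_ne hv with hneg | hpos
  · have hinv : 0 < v g⁻¹ := by
      rw [v.map_inv]
      have h0 : v g ≠ ⊤ := v.ne_top_iff.2 hg
      lift v g to Γ using h0 with a
      norm_cast at hneg ⊢
      exact neg_pos.2 hneg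
    have h1 : Differential.logDeriv g⁻¹ ≠ 0 :=
      div_ne_zero (h.deriv_ne_zero (inv_ne_zero hg) hinv) (inv_ne_zero hg)
    rw [logDeriv_inv_aux hg] at h1
    exact neg_ne_zero.1 h1
  · exact div_ne_zero (h.deriv_ne_zero hg hpos) hg

/-- In an asymptotic field, `ψ (v g) = v (g†)` for all nonzero `g` with `v g ≠ 0`. -/
lemma IsAsymptoticField.coe_fieldPsi (h : IsAsymptoticField v) {γ : Γ} (hγ : γ ≠ 0) {g : K}
    (hg : v g = (γ : WithTop Γ)) :
    ((fieldPsi v γ : Γ) : WithTop Γ) = v (Differential.logDeriv g) := by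
  have hne : ∀ f : K, v f = (γ : WithTop Γ) → f ≠ 0 ∧ v f ≠ 0 := fun f hf =>
    ⟨v.ne_top_iff.1 (hf ▸ WithTop.coe_ne_top), by rw [hf]; exact_mod_cast hγ⟩
  obtain ⟨δ, hδ⟩ := WithTop.ne_top_iff_exists.1 (h.val_logDeriv_ne_top (hne g hg).1 (hne g hg).2)
  have hex : ∃ δ : Γ, ∀ f : K, v f = (γ : WithTop Γ) →
      v (Differential.logDeriv f) = (δ : WithTop Γ) :=
    ⟨δ, fun f hf => by rw [hδ]; exact h.val_logDeriv_eq (hne g hg).1 (hne g hg).2 (hf.trans hg.symm)⟩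
  exact (Classical.epsilon_spec hex g hg).symm

/-- The pair `(Γ, ψ)` of an asymptotic field is an asymptotic couple. -/
lemma IsAsymptoticField.isAsymptoticCouple (h : IsAsymptoticField v) :
    IsAsymptoticCouple (fieldPsi v) := by
  have hne : ∀ {f : K} {γ : Γ}, v f = (γ : WithTop Γ) → f ≠ 0 := fun hf =>
    v.ne_top_iff.1 (hf ▸ WithTop.coe_ne_top)
  have ac1 : ∀ α β : Γ, α ≠ 0 → β ≠ 0 → α + β ≠ 0 →
      min (fieldPsi v α) (fieldPsi v β) ≤ fieldPsi v (α + β) := by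
    intro α β hα hβ hαβ
    obtain ⟨f, hf⟩ := h.surjective (α : WithTop Γ)
    obtain ⟨g, hg⟩ := h.surjective (β : WithTop Γ)
    have hfg : v (f * g) = ((α + β : Γ) : WithTop Γ) := by rw [v.map_mul, hf, hg]; rfl
    have : ((min (fieldPsi v α) (fieldPsi v β) : Γ) : WithTop Γ)
        ≤ ((fieldPsi v (α + β) : Γ) : WithTop Γ) := by
      rw [WithTop.coe_min, h.coe_fieldPsi hα hf, h.coe_fieldPsi hβ hg, h.coe_fieldPsi hαβ hfg,
        Differential.logDeriv_mul _ _ (hne hf) (hne hg)]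
      exact v.map_add _ _
    exact_mod_cast this
  have hnat : ∀ (n : ℕ) (α : Γ), n ≠ 0 → α ≠ 0 → fieldPsi v (n • α) = fieldPsi v α := by
    intro n α hn hα
    obtain ⟨f, hf⟩ := h.surjective (α : WithTop Γ)
    have hp : v (f ^ n) = ((n • α : Γ) : WithTop Γ) := by rw [v.map_pow, hf]; rfl
    have := h.charZero
    have hn0 : v (n : K) = 0 := by
      have h1 : 0 ≤ v ((n : ℚ) : K) := h.rat_mem n
      have h2 : 0 ≤ v (((n : ℚ)⁻¹ : ℚ) : K) := h.rat_mem _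
      have h3 : v (n : K) + v ((n : K)⁻¹) = 0 := by
        rw [← v.map_mul, mul_inv_cancel₀ (by exact_mod_cast hn), v.map_one]
      push_cast at h1 h2
      exact le_antisymm (by calc v (n : K) ≤ v (n : K) + v ((n : K)⁻¹) := le_add_of_nonneg_right h2
                            _ = 0 := h3) h1
    have : ((fieldPsi v (n • α) : Γ) : WithTop Γ) = ((fieldPsi v α : Γ) : WithTop Γ) := by
      rw [h.coe_fieldPsi (smul_ne_zero hn hα) hp, h.coe_fieldPsi hα hf, Differential.logDeriv_pow,
        v.map_mul, hn0, zero_add]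
    exact_mod_cast this
  have hneg : ∀ α : Γ, α ≠ 0 → fieldPsi v (-α) = fieldPsi v α := by
    intro α hα
    obtain ⟨f, hf⟩ := h.surjective (α : WithTop Γ)
    have hp : v f⁻¹ = ((-α : Γ) : WithTop Γ) := by rw [v.map_inv, hf]; rfl
    have : ((fieldPsi v (-α) : Γ) : WithTop Γ) = ((fieldPsi v α : Γ) : WithTop Γ) := by
      rw [h.coe_fieldPsi (neg_ne_zero.2 hα) hp, h.coe_fieldPsi hα hf, logDeriv_inv_aux (hne hf),
        v.map_neg]
    exact_mod_cast this
  have ac3 : ∀ α β : Γ, 0 < α → 0 < β → fieldPsi v β < α + fieldPsi v α := by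
    intro α β hα hβ
    obtain ⟨f, hf⟩ := h.surjective (α : WithTop Γ)
    obtain ⟨g, hg⟩ := h.surjective (β : WithTop Γ)
    have hfg : v (f * g) = ((α + β : Γ) : WithTop Γ) := by rw [v.map_mul, hf, hg]; rfl
    have e1 := h.coe_fieldPsi hα.ne' hf
    have e2 := h.coe_fieldPsi hβ.ne' hg
    have e3 := h.coe_fieldPsi (add_pos hα hβ).ne' hfg
    have hd : ∀ {k : K} {γ : Γ}, v k = γ → ((fieldPsi v γ : Γ) : WithTop Γ) =
        v (Differential.logDeriv k) → v (k′) = ((γ + fieldPsi v γ : Γ) : WithTop Γ) := by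
      intro k γ hk hl
      have : k′ = k * Differential.logDeriv k := by
        rw [Differential.logDeriv, mul_div_cancel₀ _ (hne hk)]
      rw [this, v.map_mul, hk, ← hl]; rfl
    have l1 : v (g′) < v ((f * g)′) := by
      refine (h.asymp (f * g) g (mul_ne_zero (hne hf) (hne hg)) (hne hg) ?_ ?_).1 ?_
      · rw [hfg]; exact_mod_cast add_pos hα hβ
      · rw [hg]; exact_mod_cast hβ
      · rw [hfg, hg]; exact_mod_cast lt_add_of_pos_left β hα
    have l2 : v (g′) < v (f * g′) := by
      rw [v.map_mul, hf, hd hg e2]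
      exact_mod_cast lt_add_of_pos_left _ hα
    have l3 : v (g′) < v (g * f′) := by
      have : g * f′ = (f * g)′ - f * g′ := by
        rw [Derivation.leibniz]; simp only [smul_eq_mul]; ring
      rw [this]
      exact (lt_min l1 l2).trans_le (v.map_sub _ _)
    rw [v.map_mul, hg, hd hf e1, hd hg e2] at l3
    have l4 : β + fieldPsi v β < β + (α + fieldPsi v α) := by exact_mod_cast l3
    exact lt_of_add_lt_add_left l4
  refine ⟨ac1, ?_, ?_⟩
  · intro k α hk hα
    obtain ⟨n, rfl | rfl⟩ := k.eq_nat_or_neg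
    · rw [natCast_zsmul]
      exact hnat n α (by exact_mod_cast hk) hα
    · have hn : n ≠ 0 := by simpa using hk
      rw [neg_smul, natCast_zsmul, hneg _ (smul_ne_zero hn hα)]
      exact hnat n α hn hα
  · intro α β hα hβ
    rcases lt_or_gt_of_ne hβ with hb | hb
    · rw [← hneg β hβ]
      exact ac3 α (-β) hα (neg_pos.2 hb)
    · exact ac3 α β hα hb

end Sanity

end ValuedDifferentialFields

/-! ### Sums with distinct values, and Hensel's lemma without monicity. -/

section ValuedFields

open Polynomial Filter

variable {F : Type*} [Field F] {Γ : Type*} [AddCommGroup Γ] [LinearOrder Γ] [IsOrderedAddMonoid Γ]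

namespace AddValuation

/-! The proof plays a fixed rate at which `y` can be approximated from `K` against the gap that
λ-freeness leaves between `K` and a putative bad element of `L`.

Rate (`exists_yardstick`): some nonzero `k ≺ 1` in `K` is such that every approximation `a` with `a
- y ≼ y` can be replaced by `b` with `b - y ≺ (a - y)k`. In particular `y` has no best approximation
in `K`. As `K` is henselian of residue characteristic zero, `P(a) ~ P(y)` for each nonzero `P` over
`K` and all `a` close enough to `y` (`eventually_map_aeval_lt`). Hence `L` has no values beyond
those of `K`, and ungroundedness passes to `L`.

Gap: suppose `f = R(y)`, with `R` rational over `K`, satisfies `f - g†† ≺ g†` for all `g ≻ 1`. Since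
`K` is λ-free, each `r` in `K` has `r - f ≽ g†` for some `g ≻ 1` in `K`, and `g† ≻ k'` because `k ≺
1`. On the other hand `R(a) - f ≺ k†` for `a` close to `y`. Passing to `b` with `b - y ≼ (a - y)k`
gains a factor `k` for `R` too (`eventually_map_div_eval_sub_mul_le`), so `R(b) - f ≼ (R(a) - f)k ≺
k†k = k'`. Then `r = R(b)` is a contradiction. -/

lemma mul_le_mul_iff_of_ne_zero (v : AddValuation F (WithTop Γ)) {x y z : F} (hz : z ≠ 0) :
    v (x * z) ≤ v (y * z) ↔ v x ≤ v y := by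
  rw [v.map_mul, v.map_mul]
  exact WithTop.add_le_add_iff_right (v.ne_top_iff.2 hz)

lemma mul_lt_mul_iff_of_ne_zero (v : AddValuation F (WithTop Γ)) {x y z : F} (hz : z ≠ 0) :
    v (x * z) < v (y * z) ↔ v x < v y := by
  rw [v.map_mul, v.map_mul]
  exact WithTop.add_lt_add_iff_right (v.ne_top_iff.2 hz)

lemma ne_zero_of_lt (v : AddValuation F (WithTop Γ)) {x y : F} (h : v x < v y) : x ≠ 0 :=
  v.ne_top_iff.1 h.ne_top

lemma inv_neg_iff (v : AddValuation F (WithTop Γ)) {x : F} (hx : x ≠ 0) :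
    v x⁻¹ < 0 ↔ 0 < v x := by
  have h := v.mul_lt_mul_iff_of_ne_zero (x := x⁻¹) (y := 1) hx
  rw [inv_mul_cancel₀ hx, one_mul, v.map_one] at h
  exact h.symm

lemma inv_pos_iff (v : AddValuation F (WithTop Γ)) {x : F} (hx : x ≠ 0) :
    0 < v x⁻¹ ↔ v x < 0 := by
  rw [← v.inv_neg_iff (inv_ne_zero hx), inv_inv]

lemma inv_nonneg_iff (v : AddValuation F (WithTop Γ)) {x : F} (hx : x ≠ 0) :
    0 ≤ v x⁻¹ ↔ v x ≤ 0 := by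
  rw [← not_lt, v.inv_neg_iff hx, not_lt]

/-- If the terms of a sum have pairwise distinct values, then the value of the sum is at most the
value of each term. -/
lemma map_sum_le_of_pairwise_ne (v : AddValuation F (WithTop Γ)) {ι : Type*} (s : Finset ι)
    (f : ι → F)
    (h : ∀ i ∈ s, ∀ j ∈ s, i ≠ j → f i ≠ 0 → f j ≠ 0 → v (f i) ≠ v (f j)) {k : ι} (hk : k ∈ s) :
    v (∑ i ∈ s, f i) ≤ v (f k) := by
  classical
  obtain ⟨m, hm, hmin⟩ := s.exists_min_image (fun i => v (f i)) ⟨k, hk⟩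
  refine le_trans ?_ (hmin k hk)
  by_cases hm0 : f m = 0
  · rw [hm0, v.map_zero]; exact le_top
  rw [← Finset.add_sum_erase s f hm]
  refine (v.map_add_eq_of_lt_left ?_).le
  refine v.map_lt_sum (v.ne_top_iff.2 hm0) fun i hi => ?_
  have his := Finset.mem_of_mem_erase hi
  by_cases hi0 : f i = 0
  · rw [hi0, v.map_zero]; exact lt_top_iff_ne_top.2 (v.ne_top_iff.2 hm0)
  · exact lt_of_le_of_ne (hmin i his) (h m hm i his (Finset.ne_of_mem_erase hi).symm hm0 hi0)

lemma map_natCast_eq_zero [CharZero F] (v : AddValuation F (WithTop Γ))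
    (h : ∀ q : ℚ, 0 ≤ v (q : F)) {n : ℕ} (hn : n ≠ 0) : v (n : F) = 0 := by
  have hn' : (n : F) ≠ 0 := by exact_mod_cast hn
  have h1 : 0 ≤ v ((n : ℚ) : F) := h n
  have h2 : 0 ≤ v (((n : ℚ)⁻¹ : ℚ) : F) := h _
  push_cast at h1 h2
  exact le_antisymm ((v.inv_nonneg_iff hn').1 h2) h1

end AddValuation

/-- A form of Hensel's lemma for polynomials that need not be monic. -/
lemma exists_root_of_henselian {v : AddValuation F (WithTop Γ)} (hv : IsHenselianValued v)
    (P : F[X]) (h0 : 0 ≤ v (P.coeff 0)) (h1 : P.coeff 1 = 1) (h2 : ∀ k, 2 ≤ k → 0 < v (P.coeff k)) :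
    ∃ z : F, 0 ≤ v z ∧ P.eval z = 0 := by
  by_cases hc : P.coeff 0 = 0
  · exact ⟨0, by rw [v.map_zero]; exact le_top, by rw [← coeff_zero_eq_eval_zero, hc]⟩
  set O := (AddValuation.toValuation v).valuationSubring
  have hmax : ∀ x : O, x ∈ IsLocalRing.maximalIdeal O ↔ 0 < v (x : F) := fun x =>
    Valuation.mem_maximalIdeal_iff _ (AddValuation.toValuation v)
  have hhens : HenselianLocalRing O := hv
  set n := P.natDegree
  have hcoef : ∀ k, 0 ≤ v (P.coeff (k + 2)) := fun k => (h2 _ (by omega)).le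
  let c0 : O := ⟨P.coeff 0, h0⟩
  let c : ℕ → O := fun k => ⟨P.coeff (k + 2), hcoef k⟩
  -- Substituting `x = c0 / z` in `P(x) = 0` and multiplying by `z ^ (n + 2) / c0` gives the monic
  -- equation `G(z) = 0`. Modulo the maximal ideal `G` is `X ^ (n + 1) * (X + 1)`, with simple root
  -- `-1`.
  let H : O[X] := ∑ k ∈ Finset.range (n + 1), C (c k * c0 ^ (k + 1)) * X ^ (n - k)
  let G : O[X] := X ^ (n + 1) * (X + C 1) + H
  have hcm : ∀ k, c k ∈ IsLocalRing.maximalIdeal O := fun k => (hmax _).2 (h2 _ (by omega))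
  have hHev : ∀ x, H.eval x ∈ IsLocalRing.maximalIdeal O := by
    intro x
    simp only [H, eval_finsetSum, eval_mul, eval_C]
    refine Ideal.sum_mem _ fun k _ => Ideal.mul_mem_right _ _ (Ideal.mul_mem_right _ _ (hcm k))
  have hHdev : ∀ x, H.derivative.eval x ∈ IsLocalRing.maximalIdeal O := by
    intro x
    simp only [H, derivative_sum, eval_finsetSum, derivative_C_mul, eval_mul, eval_C]
    refine Ideal.sum_mem _ fun k _ => Ideal.mul_mem_right _ _ (Ideal.mul_mem_right _ _ (hcm k))
  have hGm : G.Monic := by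
    have hm : (X ^ (n + 1) * (X + C 1) : O[X]).Monic := (monic_X_pow _).mul (monic_X_add_C 1)
    refine hm.add_of_left ?_
    have : (X ^ (n + 1) * (X + C 1) : O[X]).degree = ((n + 2 : ℕ) : WithBot ℕ) := by
      rw [degree_mul, degree_X_pow, degree_X_add_C]; norm_cast
    rw [this]
    refine lt_of_le_of_lt (degree_sum_le _ _) ((Finset.sup_lt_iff (WithBot.bot_lt_coe _)).2 ?_)
    intro k _
    refine lt_of_le_of_lt (degree_C_mul_X_pow_le _ _) ?_
    exact_mod_cast (by omega : n - k < n + 2)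
  obtain ⟨z, hz, hzm⟩ := hhens.is_henselian G hGm (-1) (by simpa [G] using hHev (-1)) (by
    have : G.derivative.eval (-1) = (-1) ^ (n + 1) + H.derivative.eval (-1) := by
      simp [G, derivative_mul]
    rw [this]
    by_contra hnu
    have h3 := (IsLocalRing.mem_maximalIdeal _).2 (mem_nonunits_iff.2 hnu)
    have h4 := (Ideal.add_mem_iff_left _ (hHdev (-1))).1 h3
    exact (mem_nonunits_iff.1 ((IsLocalRing.mem_maximalIdeal _).1 h4)) (isUnit_one.neg.pow _))
  have hz0 : v (z : F) = 0 := by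
    have h3 : 0 < v ((z : F) + 1) := by
      have := (hmax _).1 hzm
      simpa using this
    have h4 : v (1 : F) < v ((z : F) + 1) := by rwa [v.map_one]
    have h5 := v.map_sub_eq_of_lt_right h4
    rw [v.map_one] at h5
    simpa using h5
  have hzne : (z : F) ≠ 0 := v.ne_top_iff.1 (by rw [hz0]; exact WithTop.zero_ne_top)
  refine ⟨P.coeff 0 / z, ?_, ?_⟩
  · rw [div_eq_mul_inv, v.map_mul]
    exact add_nonneg h0 ((v.inv_nonneg_iff hzne).2 hz0.le)
  · have hzF : ((z : F)) ^ (n + 1) * (z + 1) + ∑ k ∈ Finset.range (n + 1),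
        P.coeff (k + 2) * P.coeff 0 ^ (k + 1) * (z : F) ^ (n - k) = 0 := by
      have h3 : G.eval z = 0 := hz
      simp only [G, H, eval_add, eval_mul, eval_pow, eval_X, eval_C, eval_finsetSum] at h3
      have h4 := congrArg (Subtype.val : O → F) h3
      simpa [c, c0] using h4
    rw [eval_eq_sum_range' (n := n + 3) (by omega), Finset.sum_range_succ', Finset.sum_range_succ']
    have h5 : ∑ k ∈ Finset.range (n + 1), P.coeff (k + 1 + 1) * (P.coeff 0 / z) ^ (k + 1 + 1) =
        P.coeff 0 / z ^ (n + 2) * ∑ k ∈ Finset.range (n + 1),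
        P.coeff (k + 2) * P.coeff 0 ^ (k + 1) * (z : F) ^ (n - k) := by
      rw [Finset.mul_sum]
      refine Finset.sum_congr rfl fun k hk => ?_
      have hk' : n + 2 = (k + 2) + (n - k) := by have := Finset.mem_range.1 hk; omega
      rw [hk', pow_add, div_pow]
      field_simp
      ring
    rw [h5, eq_neg_of_add_eq_zero_right hzF]
    simp only [zero_add, h1, pow_zero, pow_one]
    field_simp
    ring

end ValuedFields

/-! ### Polynomials near an element without best approximation. -/

section Approximation

open Polynomial Filter

variable {K L : Type*} [Field K] [Field L] [Algebra K L]
variable {Γ : Type*} [AddCommGroup Γ] [LinearOrder Γ] [IsOrderedAddMonoid Γ]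

lemma AddValuation.pow_succ_lt_pow_succ (w : AddValuation L (WithTop Γ)) {x z : L}
    (h : w x < w z) (m : ℕ) : w (x ^ (m + 1)) < w (z ^ (m + 1)) := by
  induction m with
  | zero => simpa using h
  | succ m ih =>
    rw [pow_succ, pow_succ z]
    refine ((w.mul_lt_mul_iff_of_ne_zero (w.ne_zero_of_lt h)).2 ih).trans_le ?_
    rw [w.map_mul, w.map_mul]
    gcongr

lemma AddValuation.pow_le_pow (w : AddValuation L (WithTop Γ)) {x z : L}
    (h : w x ≤ w z) (m : ℕ) : w (x ^ m) ≤ w (z ^ m) := by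
  rw [w.map_pow, w.map_pow]
  gcongr

/-- The filter on `K` describing the approach to `y ∈ L` by elements of `K`. -/
def approxFilter (K : Type*) {L : Type*} [Field K] [Field L] [Algebra K L]
    {Γ : Type*} [AddCommGroup Γ] [LinearOrder Γ] [IsOrderedAddMonoid Γ]
    (w : AddValuation L (WithTop Γ)) (y : L) : Filter K :=
  ⨅ a : K, 𝓟 {b | w (algebraMap K L a - y) < w (algebraMap K L b - y)}

variable {w : AddValuation L (WithTop Γ)} {y : L}

lemma eventually_approxFilter_iff {p : K → Prop} :
    (∀ᶠ a in approxFilter K w y, p a) ↔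
      ∃ a : K, ∀ b : K, w (algebraMap K L a - y) < w (algebraMap K L b - y) → p b := by
  have hdir : Directed (· ≥ ·)
      fun a : K => {b | w (algebraMap K L a - y) < w (algebraMap K L b - y)} := by
    intro a b
    rcases le_total (w (algebraMap K L a - y)) (w (algebraMap K L b - y)) with h | h
    · exact ⟨b, fun x hx => h.trans_lt hx, le_rfl⟩
    · exact ⟨a, le_rfl, fun x hx => h.trans_lt hx⟩
  rw [approxFilter, (hasBasis_iInf_principal hdir).eventually_iff]
  simp

lemma eventually_approx_lt (a : K) :
    ∀ᶠ b in approxFilter K w y, w (algebraMap K L a - y) < w (algebraMap K L b - y) :=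
  eventually_approxFilter_iff.2 ⟨a, fun _ h => h⟩

lemma approxFilter_neBot
    (hno : ∀ a : K, ∃ b : K, w (algebraMap K L a - y) < w (algebraMap K L b - y)) :
    (approxFilter K w y).NeBot := by
  refine ⟨fun h => ?_⟩
  obtain ⟨a, ha⟩ := (eventually_approxFilter_iff (w := w) (y := y) (p := fun _ : K => False)).1
    (by rw [h]; exact eventually_bot)
  obtain ⟨b, hb⟩ := hno a
  exact ha b hb

lemma Transcendental.algebraMap_sub_ne_zero (hy : Transcendental K y) (a : K) :
    algebraMap K L a - y ≠ 0 := fun h =>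
  hy (by rw [← sub_eq_zero.1 h]; exact isAlgebraic_algebraMap a)

/-- Two monomials of different degrees can agree in value at one distance from `y` only; any
strictly closer `a` separates them. -/
lemma eventually_map_mul_pow_ne (hy : Transcendental K y) {c d : L} (hc : c ≠ 0) (hd : d ≠ 0)
    {i j : ℕ} (hij : i ≠ j) :
    ∀ᶠ a in approxFilter K w y,
      w (c * (algebraMap K L a - y) ^ i) ≠ w (d * (algebraMap K L a - y) ^ j) := by
  wlog h : i < j generalizing i j c d
  · exact (this hd hc hij.symm (by omega)).mono fun a ha => ha.symm
  obtain ⟨m, rfl⟩ := Nat.exists_eq_add_of_lt h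
  have key : ∀ x : L, x ≠ 0 → w (c * x ^ i) = w (d * x ^ (i + m + 1)) →
      w c = w (x ^ (m + 1) * d) := by
    intro x hx he
    have h1 : d * x ^ (i + m + 1) = x ^ (m + 1) * d * x ^ i := by ring
    rw [h1] at he
    exact le_antisymm ((w.mul_le_mul_iff_of_ne_zero (pow_ne_zero i hx)).1 he.le)
      ((w.mul_le_mul_iff_of_ne_zero (pow_ne_zero i hx)).1 he.ge)
  by_cases hex : ∃ a : K,
      w (c * (algebraMap K L a - y) ^ i) = w (d * (algebraMap K L a - y) ^ (i + m + 1))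
  · obtain ⟨a, ha⟩ := hex
    filter_upwards [eventually_approx_lt a] with b hb he
    have h1 := key _ (hy.algebraMap_sub_ne_zero a) ha
    have h2 := key _ (hy.algebraMap_sub_ne_zero b) he
    exact ((w.mul_lt_mul_iff_of_ne_zero hd).2 (w.pow_succ_lt_pow_succ hb m)).ne (h1 ▸ h2)
  · exact Eventually.of_forall (not_exists.1 hex)

/-- Close to `y` the nonzero monomials of `Q` have distinct values, so nothing cancels and the sum
dominates each of them. -/
lemma eventually_map_eval_le (hy : Transcendental K y) (Q : L[X]) :
    ∀ᶠ a in approxFilter K w y, ∀ k,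
      w (Q.eval (algebraMap K L a - y)) ≤ w (Q.coeff k * (algebraMap K L a - y) ^ k) := by
  have h : ∀ᶠ a in approxFilter K w y, ∀ i ∈ Q.support, ∀ j ∈ Q.support, i ≠ j →
      w (Q.coeff i * (algebraMap K L a - y) ^ i) ≠ w (Q.coeff j * (algebraMap K L a - y) ^ j) := by
    rw [eventually_all_finset]
    intro i hi
    rw [eventually_all_finset]
    intro j hj
    by_cases hij : i = j
    · exact Eventually.of_forall fun a h => absurd hij h
    · exact (eventually_map_mul_pow_ne hy (mem_support_iff.1 hi) (mem_support_iff.1 hj) hij).mono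
        fun a h _ => h
  filter_upwards [h] with a ha k
  by_cases hk : k ∈ Q.support
  · rw [eval_eq_sum, Polynomial.sum]
    exact w.map_sum_le_of_pairwise_ne Q.support
      (fun i => Q.coeff i * (algebraMap K L a - y) ^ i) (fun i hi j hj hij _ _ => ha i hi j hj hij) hk
  · rw [notMem_support_iff.1 hk, zero_mul, w.map_zero]
    exact le_top

lemma taylor_map_eval_sub (P : K[X]) (a : K) :
    (taylor y (P.map (algebraMap K L))).eval (algebraMap K L a - y) =
      algebraMap K L (P.eval a) := by
  rw [taylor_eval, sub_add_cancel, eval_map_algebraMap, aeval_algebraMap_apply_eq_algebraMap_eval]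

lemma coeff_taylor_map (P : K[X]) (k : ℕ) :
    (taylor y (P.map (algebraMap K L))).coeff k = aeval y (hasseDeriv k P) := by
  have : hasseDeriv k (P.map (algebraMap K L)) = (hasseDeriv k P).map (algebraMap K L) := by
    ext n
    simp [hasseDeriv_coeff]
  rw [taylor_coeff, this, eval_map_algebraMap]

/-- Suppose `K` is henselian of residue characteristic zero, and `y` is transcendental over `K`
without best approximation in `K`. Then the value of any nonzero polynomial over `K` at `y` is
approximated, up to equivalence, by its values at elements of `K` close to `y`. -/
theorem eventually_map_aeval_lt [CharZero K] (hy : Transcendental K y)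
    (hno : ∀ a : K, ∃ b : K, w (algebraMap K L a - y) < w (algebraMap K L b - y))
    (hnat : ∀ n : ℕ, n ≠ 0 → w (n : L) = 0)
    (hroot : ∀ P : K[X], 0 ≤ w (algebraMap K L (P.coeff 0)) → P.coeff 1 = 1 →
      (∀ k, 2 ≤ k → 0 < w (algebraMap K L (P.coeff k))) →
      ∃ z : K, 0 ≤ w (algebraMap K L z) ∧ P.eval z = 0)
    (P : K[X]) (hP : P ≠ 0) :
    ∀ᶠ a in approxFilter K w y, w (aeval y P) < w (algebraMap K L (P.eval a) - aeval y P) := by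
  classical
  have hyP : ∀ Q : K[X], Q ≠ 0 → aeval y Q ≠ 0 := fun Q hQ h => hy ⟨Q, hQ, h⟩
  have := approxFilter_neBot hno
  induction hn : P.natDegree using Nat.strong_induction_on generalizing P with
  | _ n ih =>
  obtain rfl | hn0 := Nat.eq_zero_or_pos n
  · refine Eventually.of_forall fun a => ?_
    rw [eq_C_of_natDegree_eq_zero hn, aeval_C, eval_C, sub_self, w.map_zero]
    refine lt_top_iff_ne_top.2 (w.ne_top_iff.2 ?_)
    have := hyP P hP
    rwa [eq_C_of_natDegree_eq_zero hn, aeval_C] at this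
  set c : ℕ → L := fun k => aeval y (hasseDeriv k P) with hc
  have hc1 : c 1 = aeval y (derivative P) := by rw [hc]; simp only [hasseDeriv_one']
  have hdne : derivative P ≠ 0 := fun h => hn0.ne' (hn ▸ derivative_eq_zero.1 h)
  have hc1ne : c 1 ≠ 0 := hc1 ▸ hyP _ hdne
  -- the linear term of the Taylor expansion at `y` dominates
  have hdom : ∀ᶠ a in approxFilter K w y, ∀ k, 2 ≤ k →
      w (c 1 * (algebraMap K L a - y)) < w (c k * (algebraMap K L a - y) ^ k) := by
    have hlt : (derivative P).natDegree < n := hn ▸ natDegree_derivative_lt (by omega)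
    filter_upwards [ih _ hlt (derivative P) hdne rfl, eventually_map_eval_le hy
      (taylor y ((derivative P).map (algebraMap K L)) - C (aeval y (derivative P)))] with a h1 h2 k hk
    obtain ⟨m, rfl⟩ := Nat.exists_eq_add_of_le' hk
    -- By induction `P'(a) - P'(y) ≺ P'(y) = c 1`, and this difference dominates its Taylor term of
    -- degree `m + 1`, whose coefficient is `(m + 2) * c (m + 2)`. The integer factor has value `0`;
    -- one more factor `a - y` gives the claim.
    have h2' := h2 (m + 1)
    rw [eval_sub, eval_C, taylor_map_eval_sub] at h2'
    have h3 := h1.trans_le h2'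
    have h4 : hasseDeriv (m + 1) (derivative P) = ((m + 2 : ℕ) : K[X]) * hasseDeriv (m + 2) P := by
      have := congrArg (fun f => f P) (hasseDeriv_comp (R := K) (m + 1) 1)
      simp only [LinearMap.comp_apply, hasseDeriv_one', LinearMap.smul_apply] at this
      rw [this, Nat.choose_succ_self_right, nsmul_eq_mul]
    rw [coeff_sub, coeff_C_succ, sub_zero, coeff_taylor_map, h4, _root_.map_mul (aeval y), map_natCast, mul_assoc,
      w.map_mul, hnat _ (by omega), zero_add, ← hc1] at h3
    have h5 := (w.mul_lt_mul_iff_of_ne_zero (hy.algebraMap_sub_ne_zero a)).2 h3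
    rwa [mul_assoc, ← pow_succ] at h5
  have hval : ∀ᶠ a in approxFilter K w y,
      w (algebraMap K L (P.eval a) - aeval y P) = w (c 1 * (algebraMap K L a - y)) := by
    filter_upwards [hdom] with a ha
    have hexp : algebraMap K L (P.eval a) = ∑ k ∈ Finset.range n,
        c (k + 2) * (algebraMap K L a - y) ^ (k + 2) + c 1 * (algebraMap K L a - y)
          + aeval y P := by
      rw [← taylor_map_eval_sub (y := y), eval_eq_sum_range' (n := n + 2),
        Finset.sum_range_succ', Finset.sum_range_succ']
      · simp [coeff_taylor_map, hc]
      · rw [natDegree_taylor, natDegree_map]; omega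
    rw [hexp, add_sub_cancel_right]
    refine w.map_add_eq_of_lt_right (w.map_lt_sum ?_ fun k _ => ha _ (by omega))
    exact w.ne_top_iff.2 (mul_ne_zero hc1ne (hy.algebraMap_sub_ne_zero a))
  by_contra hcon
  have hfreq : ∃ᶠ a in approxFilter K w y,
      w (algebraMap K L (P.eval a) - aeval y P) ≤ w (aeval y P) :=
    (not_eventually.1 hcon).mono fun a ha => not_lt.1 ha
  -- Failure recurs at points `b` closer to `y` than any given `a`, and there `P(b) - P(y) ≍ c 1 *
  -- (b - y) ≺ c 1 * (a - y)`.
  have hlin : ∀ a : K, w (c 1 * (algebraMap K L a - y)) ≤ w (aeval y P) := by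
    intro a
    obtain ⟨b, hb1, hb2, hb3⟩ := (hfreq.and_eventually (hval.and (eventually_approx_lt a))).exists
    refine le_trans ?_ (hb2 ▸ hb1)
    rw [mul_comm (c 1), mul_comm (c 1)]
    exact ((w.mul_lt_mul_iff_of_ne_zero hc1ne).2 hb3).le
  have hstab : ∀ᶠ a in approxFilter K w y, ∀ k ∈ Finset.range (n + 1), k ≠ 0 →
      w (algebraMap K L ((hasseDeriv k P).eval a)) = w (c k) := by
    rw [eventually_all_finset]
    intro k _
    by_cases hk : k = 0
    · exact Eventually.of_forall fun a h => absurd hk h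
    by_cases h0 : hasseDeriv k P = 0
    · exact Eventually.of_forall fun a _ => by simp [hc, h0]
    · refine (ih _ ?_ _ h0 rfl).mono fun a ha _ => w.map_eq_of_lt_sub ha
      exact lt_of_le_of_lt (natDegree_hasseDeriv_le P k) (by omega)
  -- Hensel's lemma gives roots of `P` arbitrarily close to `y`
  have hroots : ∀ᶠ a in approxFilter K w y, ∃ z ∈ P.roots.toFinset,
      w (algebraMap K L a - y) ≤ w (algebraMap K L z - y) := by
    filter_upwards [hdom, hval, hstab] with a h1 h2 h3
    obtain ⟨b, hb⟩ := hno a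
    -- A strictly better approximation `b` provides an element of `K` with the value of `a - y`.
    set d : K := b - a with hd
    have hwd : w (algebraMap K L d) = w (algebraMap K L a - y) := by
      have : algebraMap K L d = (algebraMap K L b - y) - (algebraMap K L a - y) := by
        rw [hd, map_sub]; ring
      rw [this, w.map_sub_eq_of_lt_right hb]
    have hdne0 : d ≠ 0 := by
      rintro h
      rw [h, map_zero, w.map_zero] at hwd
      exact w.ne_top_iff.2 (hy.algebraMap_sub_ne_zero a) hwd.symm
    set e : K := (hasseDeriv 1 P).eval a
    have hwe : w (algebraMap K L e) = w (c 1) := h3 1 (Finset.mem_range.2 (by omega)) one_ne_zero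
    have hene0 : e ≠ 0 := by
      rintro h
      rw [h, map_zero, w.map_zero] at hwe
      exact w.ne_top_iff.2 hc1ne hwe.symm
    have hwed : w (algebraMap K L (e * d)) = w (c 1 * (algebraMap K L a - y)) := by
      rw [map_mul, w.map_mul, w.map_mul, hwe, hwd]
    -- `T(X) = P(a + dX) / (e * d)` has linear coefficient `1`. Its constant term is integral by
    -- `hlin`, its higher terms infinitesimal by `hdom`, so an integral root of `T` is a root of `P`
    -- at least as close to `y` as `a`.
    set T : K[X] := C (e * d)⁻¹ * (taylor a P).comp (C d * X) with hT
    have hTc : ∀ k, T.coeff k * (e * d) = (hasseDeriv k P).eval a * d ^ k := by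
      intro k
      rw [hT, coeff_C_mul, comp_C_mul_X_coeff, taylor_coeff]
      field_simp
    have hed : e * d ≠ 0 := mul_ne_zero hene0 hdne0
    have hED : algebraMap K L (e * d) ≠ 0 := (_root_.map_ne_zero _).2 hed
    have hT0 : 0 ≤ w (algebraMap K L (T.coeff 0)) := by
      rw [← w.map_one, ← w.mul_le_mul_iff_of_ne_zero hED, one_mul, ← map_mul, hTc 0, hwed,
        hasseDeriv_zero', pow_zero, mul_one]
      have : algebraMap K L (P.eval a) =
        (algebraMap K L (P.eval a) - aeval y P) + aeval y P := by ring
      rw [this]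
      exact w.map_le_add h2.ge (hlin a)
    have hT1 : T.coeff 1 = 1 := by
      have := hTc 1
      rw [pow_one] at this
      exact mul_right_cancel₀ hed (by rw [this, one_mul])
    have hT2 : ∀ k, 2 ≤ k → 0 < w (algebraMap K L (T.coeff k)) := by
      intro k hk
      by_cases hkn : k ≤ n
      · have h5 : w (algebraMap K L ((hasseDeriv k P).eval a * d ^ k)) =
            w (c k * (algebraMap K L a - y) ^ k) := by
          rw [_root_.map_mul (algebraMap K L), map_pow, w.map_mul, w.map_mul, w.map_pow, w.map_pow,
            hwd, h3 k (Finset.mem_range.2 (by omega)) (by omega)]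
        rw [← w.map_one, ← w.mul_lt_mul_iff_of_ne_zero hED, one_mul, ← map_mul, hTc k, hwed, h5]
        exact h1 k hk
      · have h5 := hTc k
        rw [hasseDeriv_eq_zero_of_lt_natDegree _ _ (by omega), eval_zero, zero_mul] at h5
        rw [(mul_eq_zero.1 h5).resolve_right hed, map_zero, w.map_zero]
        exact WithTop.coe_lt_top 0
    obtain ⟨x, hx, hx0⟩ := hroot T hT0 hT1 hT2
    refine ⟨a + d * x, ?_, ?_⟩
    · rw [Multiset.mem_toFinset, mem_roots hP, IsRoot.def]
      rw [hT, eval_mul, eval_C, eval_comp, eval_mul, eval_C, eval_X, taylor_eval] at hx0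
      rw [add_comm]
      exact (mul_eq_zero.1 hx0).resolve_left (inv_ne_zero hed)
    · have : algebraMap K L (a + d * x) - y =
          (algebraMap K L a - y) + algebraMap K L d * algebraMap K L x := by
        rw [map_add, map_mul]; ring
      rw [this]
      refine w.map_le_add le_rfl ?_
      rw [w.map_mul, hwd]
      exact le_add_of_nonneg_right hx
  -- `P` has finitely many roots, so points closer to `y` than all of them exist.
  have hfar : ∀ᶠ a in approxFilter K w y, ∀ z ∈ P.roots.toFinset,
      w (algebraMap K L z - y) < w (algebraMap K L a - y) := by
    rw [eventually_all_finset]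
    exact fun z _ => eventually_approx_lt z
  obtain ⟨a, ⟨z, hz, h1⟩, h2⟩ := (hroots.and hfar).exists
  exact h1.not_gt (h2 z hz)

end Approximation

/-! ### Asymptotic couples of `H`-type. -/

section AsymptoticCoupleLemmas

variable {Γ : Type*} [AddCommGroup Γ] [LinearOrder Γ] [IsOrderedAddMonoid Γ] {ψ : Γ → Γ}

lemma IsAsymptoticCouple.lt_psi_sub (h : IsAsymptoticCouple ψ) {α β : Γ} (hβ : β ≠ 0)
    (hlt : ψ α < ψ β) : ψ α < ψ (ψ β - ψ α) := by
  have h1 := h.ac3 (ψ β - ψ α) β (sub_pos.2 hlt) hβ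
  rw [sub_add_eq_add_sub, add_sub_assoc] at h1
  exact sub_pos.1 (pos_of_lt_add_right h1)

/-- In an asymptotic couple of `H`-type, the set `(Γ^>)'` is closed upward. -/
lemma IsAsymptoticCouple.mem_derivPosSet_of_le (h : IsAsymptoticCouple ψ) (hH : IsHTypeCouple ψ)
    {γ α : Γ} (hγ : γ ∈ derivPosSet ψ) (hle : γ ≤ α) : α ∈ derivPosSet ψ := by
  obtain ⟨β, hβ, rfl⟩ := hγ
  have h1 : β ≤ α - ψ β := le_sub_iff_add_le.2 hle
  have h2 : 0 < α - ψ β := hβ.trans_le h1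
  obtain heq | hlt := (hH _ _ hβ h1).eq_or_lt
  · exact ⟨α - ψ β, h2, by rw [heq, sub_add_cancel]⟩
  -- The candidate `α - ψ β` misses `α` by `δ = ψ β - ψ (α - ψ β)`. Since `ψ δ` is larger than `ψ (α
  -- - ψ β)`, adding `δ` leaves `ψ` unchanged and corrects the error exactly.
  · have h3 := h.lt_psi_sub hβ.ne' hlt
    have h4 : 0 < ψ β - ψ (α - ψ β) := sub_pos.2 hlt
    have h5 : ψ ((α - ψ β) + (ψ β - ψ (α - ψ β))) = ψ (α - ψ β) := by
      refine le_antisymm (hH _ _ h2 (le_add_of_nonneg_right h4.le)) ?_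
      have := h.ac1 _ _ h2.ne' h4.ne' (add_pos h2 h4).ne'
      rwa [min_eq_left h3.le] at this
    exact ⟨_, add_pos h2 h4, by rw [h5]; abel⟩

end AsymptoticCoupleLemmas

/-! ### The couple axioms read off in the field. -/

section AsymptoticFields

variable {F : Type*} [Field F] [Differential F]
variable {Γ : Type*} [AddCommGroup Γ] [LinearOrder Γ] [IsOrderedAddMonoid Γ]
variable {v : AddValuation F (WithTop Γ)}

lemma mul_logDeriv_eq_deriv {g : F} (hg : g ≠ 0) : g * Differential.logDeriv g = g′ := by
  rw [Differential.logDeriv, mul_div_cancel₀ _ hg]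

lemma IsAsymptoticField.val_logDeriv_lt_val_deriv (h : IsAsymptoticField v) {x z : F}
    (hx : x ≠ 0) (hx0 : 0 < v x) (hz : z ≠ 0) (hz0 : v z ≠ 0) :
    v (Differential.logDeriv z) < v (x′) := by
  obtain ⟨α, hα⟩ := WithTop.ne_top_iff_exists.1 (v.ne_top_iff.2 hx)
  obtain ⟨β, hβ⟩ := WithTop.ne_top_iff_exists.1 (v.ne_top_iff.2 hz)
  have hα0 : 0 < α := by rw [← hα] at hx0; exact_mod_cast hx0
  have hβ0 : β ≠ 0 := by rw [← hβ] at hz0; exact_mod_cast hz0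
  rw [← mul_logDeriv_eq_deriv hx, v.map_mul, ← h.coe_fieldPsi hβ0 hβ.symm,
    ← h.coe_fieldPsi hα0.ne' hα.symm, ← hα]
  exact_mod_cast h.isAsymptoticCouple.ac3 α β hα0 hβ0

lemma IsHAsymptotic.val_logDeriv_le (h : IsHAsymptotic v) {x z : F}
    (hx0 : 0 < v x) (hz : z ≠ 0) (hxz : v x ≤ v z) :
    v (Differential.logDeriv z) ≤ v (Differential.logDeriv x) := by
  obtain ⟨β, hβ⟩ := WithTop.ne_top_iff_exists.1 (v.ne_top_iff.2 hz)
  obtain ⟨α, hα⟩ := WithTop.ne_top_iff_exists.1 (ne_top_of_le_ne_top (v.ne_top_iff.2 hz) hxz)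
  have hα0 : 0 < α := by rw [← hα] at hx0; exact_mod_cast hx0
  have hαβ : α ≤ β := by rw [← hα, ← hβ] at hxz; exact_mod_cast hxz
  rw [← h.coe_fieldPsi hα0.ne' hα.symm, ← h.coe_fieldPsi (hα0.trans_le hαβ).ne' hβ.symm]
  exact_mod_cast h.hType α β hα0 hαβ

lemma IsHAsymptotic.exists_val_deriv_eq (h : IsHAsymptotic v) {t : F} (ht : t ≠ 0) {γ : Γ}
    (hγ : γ ∈ derivPosSet (fieldPsi v)) (hle : (γ : WithTop Γ) ≤ v t) :
    ∃ g : F, g ≠ 0 ∧ 0 < v g ∧ v (g′) = v t := by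
  obtain ⟨α, hα⟩ := WithTop.ne_top_iff_exists.1 (v.ne_top_iff.2 ht)
  have hγα : γ ≤ α := by rw [← hα] at hle; exact_mod_cast hle
  obtain ⟨β, hβ, hβα⟩ := h.isAsymptoticCouple.mem_derivPosSet_of_le h.hType hγ hγα
  obtain ⟨g, hg⟩ := h.surjective (β : WithTop Γ)
  have hg0 : g ≠ 0 := v.ne_top_iff.1 (hg ▸ WithTop.coe_ne_top)
  refine ⟨g, hg0, by rw [hg]; exact_mod_cast hβ, ?_⟩
  rw [← mul_logDeriv_eq_deriv hg0, v.map_mul, ← h.coe_fieldPsi hβ.ne' hg, hg, ← hα, ← hβα]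
  rfl

/-- If `(Γ, ψ)` is ungrounded, then the values `v (g†)` with `g ≺ 1` have no maximum. -/
lemma IsAsymptoticField.exists_val_logDeriv_lt (h : IsAsymptoticField v)
    (hu : ¬ IsGroundedCouple (fieldPsi v)) {g : F} (hg : g ≠ 0) (hg0 : v g ≠ 0) :
    ∃ x : F, x ≠ 0 ∧ 0 < v x ∧ v (Differential.logDeriv g) < v (Differential.logDeriv x) := by
  by_contra! hcon
  apply hu
  obtain ⟨γ, hγ⟩ := WithTop.ne_top_iff_exists.1 (v.ne_top_iff.2 hg)
  have hγ0 : γ ≠ 0 := by rw [← hγ] at hg0; exact_mod_cast hg0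
  refine ⟨fieldPsi v γ, ⟨γ, hγ0, rfl⟩, ?_⟩
  rintro _ ⟨β, hβ, rfl⟩
  obtain ⟨x, hx⟩ := h.surjective (β : WithTop Γ)
  have hx0 : x ≠ 0 := v.ne_top_iff.1 (hx ▸ WithTop.coe_ne_top)
  have : v (Differential.logDeriv x) ≤ v (Differential.logDeriv g) := by
    rcases lt_or_gt_of_ne hβ with hneg | hpos
    · have hinv := hcon x⁻¹ (inv_ne_zero hx0)
        ((v.inv_pos_iff hx0).2 (by rw [hx]; exact_mod_cast hneg))
      rwa [logDeriv_inv_aux hx0, v.map_neg] at hinv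
    · exact hcon x hx0 (by rw [hx]; exact_mod_cast hpos)
  rw [← h.coe_fieldPsi hβ hx, ← h.coe_fieldPsi hγ0 hγ.symm] at this
  exact_mod_cast this

end AsymptoticFields

/-! ### Rational functions inherit the rate of approximation. -/

section RationalFunctions

open Polynomial Filter

variable {K L : Type*} [Field K] [Field L] [Algebra K L]
variable {Γ : Type*} [AddCommGroup Γ] [LinearOrder Γ] [IsOrderedAddMonoid Γ]
variable {w : AddValuation L (WithTop Γ)} {y : L}

/-- The expansion of `T` at `y` has no constant term, so shrinking the distance by `k ≼ 1` shrinks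
each term by at least `k`; and `T(a)` dominates each of its own terms. -/
lemma eventually_map_eval_mul_le (hy : Transcendental K y) (T : L[X]) (hT : T.eval y = 0) {k : L}
    (hk : 0 ≤ w k) :
    ∀ᶠ a in approxFilter K w y, ∀ b : K,
      w ((algebraMap K L a - y) * k) ≤ w (algebraMap K L b - y) →
      w (T.eval (algebraMap K L a) * k) ≤ w (T.eval (algebraMap K L b)) := by
  filter_upwards [eventually_map_eval_le hy (taylor y T)] with a ha b hab
  have hev : ∀ x, T.eval x = (taylor y T).eval (x - y) := fun x => by
    rw [taylor_eval, sub_add_cancel]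
  rw [hev (algebraMap K L b), eval_eq_sum (p := taylor y T), Polynomial.sum]
  refine w.map_le_sum fun i _ => ?_
  cases i with
  | zero =>
    rw [taylor_coeff_zero, hT, zero_mul, w.map_zero]
    exact le_top
  | succ m =>
    have h1 := ha (m + 1)
    rw [← hev] at h1
    have h2 := w.pow_le_pow hab (m + 1)
    have h3 : ((algebraMap K L a - y) * k) ^ (m + 1) =
        (algebraMap K L a - y) ^ (m + 1) * k * k ^ m := by rw [mul_pow]; ring
    have h4 : 0 ≤ w (k ^ m) := by rw [w.map_pow]; exact nsmul_nonneg hk m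
    rw [h3, w.map_mul, w.map_mul] at h2
    rw [w.map_mul] at h1 ⊢
    rw [w.map_mul]
    calc w (T.eval (algebraMap K L a)) + w k
        ≤ (w ((taylor y T).coeff (m + 1)) + w ((algebraMap K L a - y) ^ (m + 1))) + w k := by gcongr
      _ ≤ w ((taylor y T).coeff (m + 1)) +
          (w ((algebraMap K L a - y) ^ (m + 1)) + w k + w (k ^ m)) := by
        rw [add_assoc]
        exact add_le_add le_rfl (le_add_of_nonneg_right h4)
      _ ≤ _ := by gcongr

lemma eventually_map_div_eval_eq
    (hstab : ∀ P : K[X], P ≠ 0 → ∀ᶠ a in approxFilter K w y,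
      w (aeval y P) < w (algebraMap K L (P.eval a) - aeval y P))
    {P Q : K[X]} (hP : P ≠ 0) (hQ : Q ≠ 0) :
    ∀ᶠ a in approxFilter K w y,
      w (algebraMap K L (P.eval a / Q.eval a)) = w (aeval y P / aeval y Q) := by
  filter_upwards [hstab P hP, hstab Q hQ] with a h1 h2
  rw [map_div₀, w.map_div, w.map_div, w.map_eq_of_lt_sub h1, w.map_eq_of_lt_sub h2]

lemma eventually_map_div_eval_sub_mul_le (hy : Transcendental K y)
    (hstab : ∀ P : K[X], P ≠ 0 → ∀ᶠ a in approxFilter K w y,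
      w (aeval y P) < w (algebraMap K L (P.eval a) - aeval y P))
    (P Q : K[X]) (hQ : Q ≠ 0) {k : L} (hk : 0 ≤ w k) :
    ∀ᶠ a in approxFilter K w y, ∀ᶠ b in approxFilter K w y,
      w ((algebraMap K L a - y) * k) ≤ w (algebraMap K L b - y) →
      w ((algebraMap K L (P.eval a / Q.eval a) - aeval y P / aeval y Q) * k) ≤
        w (algebraMap K L (P.eval b / Q.eval b) - aeval y P / aeval y Q) := by
  have hQy : aeval y Q ≠ 0 := fun h => hy ⟨Q, hQ, h⟩
  -- `T` vanishes at `y`, and `T(a) = (P(a)/Q(a) - P(y)/Q(y)) * Q(a) * Q(y)` with `Q(a) ≍ Q(y)`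
  -- close to `y`.
  set T : L[X] := C (aeval y Q) * P.map (algebraMap K L) - C (aeval y P) * Q.map (algebraMap K L)
    with hTdef
  have hTev : ∀ a : K, T.eval (algebraMap K L a) =
      aeval y Q * algebraMap K L (P.eval a) - aeval y P * algebraMap K L (Q.eval a) := by
    intro a
    simp [hTdef, aeval_algebraMap_apply_eq_algebraMap_eval]
  have hT : T.eval y = 0 := by
    simp [hTdef, mul_comm]
  have hval : ∀ᶠ a in approxFilter K w y,
      w (algebraMap K L (P.eval a / Q.eval a) - aeval y P / aeval y Q) +
        (w (aeval y Q) + w (aeval y Q)) = w (T.eval (algebraMap K L a)) := by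
    filter_upwards [hstab Q hQ] with a ha
    have h1 := w.map_eq_of_lt_sub ha
    have h2 : algebraMap K L (Q.eval a) ≠ 0 := w.ne_top_iff.1 (h1 ▸ w.ne_top_iff.2 hQy)
    nth_rw 2 [← h1]
    rw [← w.map_mul, ← w.map_mul, hTev, map_div₀]
    congr 1
    field_simp
  filter_upwards [eventually_map_eval_mul_le hy T hT hk, hval] with a h1 h2
  filter_upwards [hval] with b h3 hab
  have h4 := h1 b hab
  rw [w.map_mul, ← h2, ← h3, add_right_comm, ← w.map_mul] at h4
  have h5 : w (aeval y Q) + w (aeval y Q) ≠ ⊤ :=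
    WithTop.add_ne_top.2 ⟨w.ne_top_iff.2 hQy, w.ne_top_iff.2 hQy⟩
  exact (WithTop.add_le_add_iff_right h5).1 h4

end RationalFunctions

/-! ### The rate at which the integral `y` is approximated. -/

section Integration

open Polynomial Filter

variable {K : Type*} [Field K] [Differential K]
  {Γ : Type*} [AddCommGroup Γ] [LinearOrder Γ] [IsOrderedAddMonoid Γ]
  {v : AddValuation K (WithTop Γ)}
  {L : Type*} [Field L] [Differential L] [Algebra K L] [DifferentialAlgebra K L]
  {ΓL : Type*} [AddCommGroup ΓL] [LinearOrder ΓL] [IsOrderedAddMonoid ΓL]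
  {w : AddValuation L (WithTop ΓL)}

/-- An integral `y ≭ 1` of `s` with `v s ∈ (Γ^>)'` is infinitesimal, and any approximation `a ∈ K`
to `y` with `y - a ≼ y` can be improved by at least a fixed positive value. -/
lemma exists_yardstick (hK : IsPreDValued v) (hH : IsHAsymptotic v)
    (hu : ¬ IsGroundedCouple (fieldPsi v))
    {s : K} (hs : ∃ γ ∈ derivPosSet (fieldPsi v), v s = (γ : WithTop Γ))
    (hL : IsHAsymptotic w)
    (hle : ∀ a b : K, w (algebraMap K L a) ≤ w (algebraMap K L b) ↔ v a ≤ v b)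
    {y : L} (hy : Transcendental K y) (hy' : y′ = algebraMap K L s) (hyv : w y ≠ 0) :
    ∃ k : K, k ≠ 0 ∧ 0 < w (algebraMap K L k) ∧ ∀ a : K, w y ≤ w (algebraMap K L a - y) →
      ∃ b : K, w ((algebraMap K L a - y) * algebraMap K L k) < w (algebraMap K L b - y) := by
  have hlt : ∀ a b : K, w (algebraMap K L a) < w (algebraMap K L b) ↔ v a < v b := fun a b => by
    rw [← not_le, hle, not_le]
  have heq : ∀ a b : K, v a = v b → w (algebraMap K L a) = w (algebraMap K L b) := fun a b h =>
    le_antisymm ((hle a b).2 h.le) ((hle b a).2 h.ge)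
  have hpos : ∀ a : K, 0 < w (algebraMap K L a) ↔ 0 < v a := fun a => by
    have := hlt 1 a
    rwa [map_one, w.map_one, v.map_one] at this
  have hcne : ∀ a : K, a ≠ 0 → algebraMap K L a ≠ 0 := fun a ha => (_root_.map_ne_zero _).2 ha
  have hy0 : y ≠ 0 := fun h => hy (h ▸ isAlgebraic_zero)
  have hval : ∀ x z : L, x ≠ 0 → z ≠ 0 → 0 < w x → 0 < w z → w (x′) = w (z′) → w x = w z := by
    intro x z hx hz hx0 hz0 hxz
    refine le_antisymm ?_ ?_
    · exact not_lt.1 fun h => ((hL.asymp x z hx hz hx0 hz0).1 h).ne hxz.symm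
    · exact not_lt.1 fun h => ((hL.asymp z x hz hx hz0 hx0).1 h).ne hxz
  obtain ⟨γ, hγ, hsγ⟩ := hs
  have hs0 : s ≠ 0 := v.ne_top_iff.1 (hsγ ▸ WithTop.coe_ne_top)
  obtain ⟨g₀, hg₀, hg₀0, hg₀s⟩ := hH.exists_val_deriv_eq hs0 hγ hsγ.ge
  have hg₀L : w (y′) = w ((algebraMap K L g₀)′) := by
    rw [hy', deriv_algebraMap]; exact (heq _ _ hg₀s).symm
  -- If `y ≻ 1`, then `y' ≽ y†`, whereas `y' ≍ g₀'` with `g₀ ≺ 1` forces `y' ≺ y†`.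
  have hypos : 0 < w y := by
    refine lt_of_le_of_ne (not_lt.1 fun hneg => ?_) hyv.symm
    have h1 := hL.val_logDeriv_lt_val_deriv (hcne _ hg₀) ((hpos _).2 hg₀0) hy0 hyv
    rw [← hg₀L, ← mul_logDeriv_eq_deriv hy0, w.map_mul] at h1
    exact h1.not_ge ((add_le_add_left hneg.le _).trans_eq (zero_add _))
  have hyg₀ : w y = w (algebraMap K L g₀) :=
    hval _ _ hy0 (hcne _ hg₀) hypos ((hpos _).2 hg₀0) hg₀L
  obtain ⟨x, hx, hx0, hx1⟩ := hK.exists_val_logDeriv_lt hu hg₀ hg₀0.ne'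
  have hl0 : Differential.logDeriv g₀ ≠ 0 := v.ne_zero_of_lt hx1
  have hlx : Differential.logDeriv x ≠ 0 := v.ne_top_iff.1 (hK.val_logDeriv_ne_top hx hx0.ne')
  -- Ungroundedness supplies `x` with `x† ≺ g₀†`. The ratio depends on `s` only, not on the
  -- approximation `a`.
  set k : K := Differential.logDeriv x / Differential.logDeriv g₀
  have hkl : k * Differential.logDeriv g₀ = Differential.logDeriv x := div_mul_cancel₀ _ hl0
  refine ⟨k, div_ne_zero hlx hl0, ?_, fun a ha => ?_⟩
  · rw [hpos, ← v.map_one, ← v.mul_lt_mul_iff_of_ne_zero hl0, one_mul, hkl]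
    exact hx1
  have hay := hy.algebraMap_sub_ne_zero a
  have haypos : 0 < w (algebraMap K L a - y) := hypos.trans_le ha
  have hder : (algebraMap K L a - y)′ = algebraMap K L (a′ - s) := by
    rw [map_sub, map_sub, deriv_algebraMap, hy']
  have hds : a′ - s ≠ 0 := by
    intro h
    rw [h, map_zero] at hder
    exact hL.deriv_ne_zero hay haypos hder
  have hdsv : v s ≤ v (a′ - s) := by
    rw [← hle, ← hder, ← hy']
    exact not_lt.1 fun h => ((hL.asymp _ _ hy0 hay hypos haypos).2 h).not_ge ha
  obtain ⟨g, hg, hg0, hgs⟩ := hH.exists_val_deriv_eq hds hγ (hsγ ▸ hdsv)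
  have hg' : g′ ≠ 0 := hK.deriv_ne_zero hg hg0
  have hga : w (algebraMap K L a - y) = w (algebraMap K L g) := by
    refine hval _ _ hay (hcne _ hg) haypos ((hpos _).2 hg0) ?_
    rw [hder, deriv_algebraMap]
    exact (heq _ _ hgs).symm
  set u : K := (a′ - s) / (g′)
  have hug : u * g′ = a′ - s := div_mul_cancel₀ _ hg'
  have hu0 : u ≠ 0 := div_ne_zero hds hg'
  have huv : 0 ≤ v u := by
    rw [← v.map_one, ← v.mul_le_mul_iff_of_ne_zero hg', one_mul, hug, hgs]
  have hu1 : v (Differential.logDeriv x) < v (u′) := hK.pdv u x hu0 hx huv hx0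
  -- Since `(a - y)' = u * g'`, subtracting `u * g` leaves an error `e` with `e' = -u' * g`.
  -- Pre-d-valuedness gives `u' ≺ x†`, so `e' ≺ x† * g ≍ k * g₀† * (a - y)`.
  refine ⟨a - u * g, ?_⟩
  set e : L := algebraMap K L (a - u * g) - y with he
  have he0 : e ≠ 0 := hy.algebraMap_sub_ne_zero _
  have hee : e = (algebraMap K L a - y) - algebraMap K L (u * g) := by
    rw [he, map_sub]; ring
  have hle1 : w y ≤ w e := by
    rw [hee]
    refine w.map_le_sub ha (ha.trans ?_)
    rw [hga, hle, v.map_mul]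
    exact le_add_of_nonneg_left huv
  have hepos : 0 < w e := hypos.trans_le hle1
  have hed : e′ = algebraMap K L (-(u′ * g)) := by
    rw [hee, map_sub, hder, deriv_algebraMap, ← map_sub, Derivation.leibniz]
    simp only [smul_eq_mul]
    rw [hug]
    congr 1
    ring
  -- As `e ≼ y ≍ g₀`, `H`-type gives `e† ≽ g₀†`, which turns the bound on `e'` into one on `e`.
  have hpsi : w (Differential.logDeriv e) ≤ w (algebraMap K L (Differential.logDeriv g₀)) := by
    rw [← Differential.logDeriv_algebraMap, ← hL.val_logDeriv_eq (hcne _ hg₀) _ hyg₀]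
    · exact hL.val_logDeriv_le hypos he0 hle1
    · exact ((hpos _).2 hg₀0).ne'
  have h1 : w (algebraMap K L (Differential.logDeriv x * g)) < w (e′) := by
    rw [hed, hlt, v.map_neg]
    exact (v.mul_lt_mul_iff_of_ne_zero hg).2 hu1
  have hL0 : algebraMap K L (Differential.logDeriv g₀) ≠ 0 := hcne _ hl0
  rw [← w.mul_lt_mul_iff_of_ne_zero hL0]
  calc w ((algebraMap K L a - y) * algebraMap K L k * algebraMap K L (Differential.logDeriv g₀))
      = w (algebraMap K L (Differential.logDeriv x * g)) := by
        rw [mul_assoc, ← _root_.map_mul (algebraMap K L), hkl, w.map_mul, hga, ← w.map_mul,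
          ← _root_.map_mul (algebraMap K L), mul_comm]
    _ < w (e′) := h1
    _ = w e + w (Differential.logDeriv e) := by rw [← mul_logDeriv_eq_deriv he0, w.map_mul]
    _ ≤ w e + w (algebraMap K L (Differential.logDeriv g₀)) := by gcongr
    _ = w (e * algebraMap K L (Differential.logDeriv g₀)) := (w.map_mul _ _).symm

end Integration

/-! ### λ-freeness of `K(y)`. -/

theorem mainTheorem5
    {K : Type*} [Field K] [Differential K]
    {Γ : Type*} [AddCommGroup Γ] [LinearOrder Γ] [IsOrderedAddMonoid Γ]
    (v : AddValuation K (WithTop Γ))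
    (hK : IsPreDValued v) (hH : IsHAsymptotic v) (hhens : IsHenselianValued v)
    (s : K) (hs : ∃ γ ∈ derivPosSet (fieldPsi v), v s = (γ : WithTop Γ))
    (hs' : ¬ ∃ ε : K, 0 < v ε ∧ ε′ = s)
    {L : Type*} [Field L] [Differential L] [Algebra K L] [DifferentialAlgebra K L]
    {ΓL : Type*} [AddCommGroup ΓL] [LinearOrder ΓL] [IsOrderedAddMonoid ΓL]
    (w : AddValuation L (WithTop ΓL))
    (hL : IsHAsymptotic w)
    (hext : (w.comap (algebraMap K L)).IsEquiv v)
    (y : L) (hy : Transcendental K y) (hgen : IntermediateField.adjoin K {y} = ⊤)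
    (hy' : y′ = algebraMap K L s) (hyv : w y ≠ 0)
    (hfree : IsLambdaFree v) :
    IsLambdaFree w := by
  have hle : ∀ a b : K, w (algebraMap K L a) ≤ w (algebraMap K L b) ↔ v a ≤ v b :=
    fun a b => hext b a
  have hlt : ∀ a b : K, w (algebraMap K L a) < w (algebraMap K L b) ↔ v a < v b := fun a b => by
    rw [← not_le, hle, not_le]
  have hpos : ∀ a : K, 0 < w (algebraMap K L a) ↔ 0 < v a := fun a => by
    have := hlt 1 a
    rwa [map_one, w.map_one, v.map_one] at this
  have hneg : ∀ a : K, w (algebraMap K L a) < 0 ↔ v a < 0 := fun a => by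
    have := hlt a 1
    rwa [map_one, w.map_one, v.map_one] at this
  have hnonneg : ∀ a : K, 0 ≤ w (algebraMap K L a) ↔ 0 ≤ v a := fun a => by
    have := hle 1 a
    rwa [map_one, w.map_one, v.map_one] at this
  have hlog : ∀ a : K, Differential.logDeriv (algebraMap K L a) =
      algebraMap K L (Differential.logDeriv a) := Differential.logDeriv_algebraMap
  have := hK.charZero
  have := hL.charZero
  obtain ⟨k, hk, hk0, hyard⟩ := exists_yardstick hK hH hfree.ungrounded hs hL hle hy hy' hyv
  have hy0 : w (algebraMap K L 0 - y) = w y := by rw [map_zero, zero_sub, w.map_neg]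
  have hno : ∀ a : K, ∃ b : K, w (algebraMap K L a - y) < w (algebraMap K L b - y) := by
    intro a
    rcases le_or_gt (w y) (w (algebraMap K L a - y)) with h | h
    · obtain ⟨b, hb⟩ := hyard a h
      refine ⟨b, lt_of_le_of_lt ?_ hb⟩
      rw [w.map_mul]
      exact le_add_of_nonneg_right hk0.le
    · exact ⟨0, hy0 ▸ h⟩
  have hNB := approxFilter_neBot hno
  have hstab := eventually_map_aeval_lt hy hno (fun n hn => w.map_natCast_eq_zero hL.rat_mem hn)
    (fun P h0 h1 h2 => by
      obtain ⟨z, hz, hz0⟩ := exists_root_of_henselian hhens P ((hnonneg _).1 h0) h1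
        fun k hk => (hpos _).1 (h2 k hk)
      exact ⟨z, (hnonneg _).2 hz, hz0⟩)
  have hfrac : ∀ f : L, ∃ P Q : Polynomial K, f = Polynomial.aeval y P / Polynomial.aeval y Q :=
    fun f => (IntermediateField.mem_adjoin_simple_iff K f).1 (hgen ▸ IntermediateField.mem_top)
  have himm : ∀ f : L, f ≠ 0 → ∃ g : K, w (algebraMap K L g) = w f := by
    intro f hf
    obtain ⟨P, Q, rfl⟩ := hfrac f
    have hP : P ≠ 0 := by rintro rfl; simp at hf
    have hQ : Q ≠ 0 := by rintro rfl; simp at hf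
    obtain ⟨a, ha⟩ := (eventually_map_div_eval_eq hstab hP hQ).exists
    exact ⟨_, ha⟩
  refine ⟨?_, ?_, ?_⟩
  · rintro ⟨γ, ⟨α, hα, hαγ⟩, hmax⟩
    obtain ⟨f, hf⟩ := hL.surjective (α : WithTop ΓL)
    obtain ⟨g, hg⟩ := himm f (w.ne_top_iff.1 (hf ▸ WithTop.coe_ne_top))
    have hgα : w (algebraMap K L g) = α := hg.trans hf
    have hg0 : g ≠ 0 := by
      rintro rfl
      rw [map_zero, w.map_zero] at hgα
      exact WithTop.top_ne_coe hgα
    have hvg : v g ≠ 0 := by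
      intro h
      have h1 := (hnonneg g).2 h.ge
      have h2 := not_lt.1 fun h' => ((hpos g).1 h').ne' h
      rw [hgα] at h1 h2
      exact hα (le_antisymm (by exact_mod_cast h2) (by exact_mod_cast h1))
    obtain ⟨x, hx, hx0, hx1⟩ := hK.exists_val_logDeriv_lt hfree.ungrounded hg0 hvg
    obtain ⟨β, hβ⟩ := WithTop.ne_top_iff_exists.1
      (w.ne_top_iff.2 ((_root_.map_ne_zero (algebraMap K L)).2 hx))
    have hβ0 : 0 < β := by
      have := (hpos x).2 hx0
      rw [← hβ] at this
      exact_mod_cast this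
    have h1 := hmax ⟨β, hβ0.ne', rfl⟩
    rw [← hlt, ← hlog, ← hlog, ← hL.coe_fieldPsi hα hgα, ← hL.coe_fieldPsi hβ0.ne' hβ.symm, hαγ]
      at hx1
    exact h1.not_gt (by exact_mod_cast hx1)
  · obtain ⟨κ, hκ⟩ := WithTop.ne_top_iff_exists.1
      (w.ne_top_iff.2 ((_root_.map_ne_zero (algebraMap K L)).2 hk))
    rw [← hκ] at hk0
    exact ⟨κ, 0, ne_of_gt (by exact_mod_cast hk0)⟩
  · intro f
    by_contra! hcon
    -- no element of `K` is close to `f`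
    have hfar : ∀ r : K, ∃ g : K, v g < 0 ∧
        w (algebraMap K L r - f) ≤ w (Differential.logDeriv (algebraMap K L g)) := by
      intro r
      obtain ⟨g, hg, hrg⟩ := hfree.exists_ge r
      refine ⟨g, hg, ?_⟩
      have h1 := hcon (algebraMap K L g) ((hneg g).2 hg)
      rw [← hle, map_sub, ← hlog, ← hlog] at hrg
      have h2 : algebraMap K L r - f =
        (algebraMap K L r - Differential.logDeriv (Differential.logDeriv (algebraMap K L g))) -
        (f - Differential.logDeriv (Differential.logDeriv (algebraMap K L g))) := by ring
      rw [h2, w.map_sub_eq_of_lt_left (hrg.trans_lt h1)]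
      exact hrg
    have hfK : ∀ r : K, algebraMap K L r ≠ f := by
      rintro r rfl
      obtain ⟨g, hg, h⟩ := hfar r
      have hg0 : algebraMap K L g ≠ 0 := (_root_.map_ne_zero _).2 (v.ne_top_iff.1 hg.ne_top)
      rw [sub_self, w.map_zero, top_le_iff] at h
      exact hL.val_logDeriv_ne_top hg0 ((hneg g).2 hg).ne h
    obtain ⟨P, Q, hf⟩ := hfrac f
    have hQ : Q ≠ 0 := by
      rintro rfl
      exact hfK 0 (by simp [hf])
    have hQy : Polynomial.aeval y Q ≠ 0 := fun h => hy ⟨Q, hQ, h⟩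
    -- With `r = g††`, the element `f - r` is again a rational function of `y`, so `R(a) - r ≍ f - r
    -- ≺ g†` close to `y`, where `R = P/Q`; now subtract.
    have hclose : ∀ g : K, v g < 0 → ∀ᶠ a in approxFilter K w y,
        w (Differential.logDeriv (algebraMap K L g)) <
          w (algebraMap K L (P.eval a / Q.eval a) - f) := by
      intro g hg
      set r : K := Differential.logDeriv (Differential.logDeriv g) with hr
      have h1 := hcon (algebraMap K L g) ((hneg g).2 hg)
      rw [hlog, hlog, ← hr] at h1
      have hfr : f - algebraMap K L r =
          Polynomial.aeval y (P - Polynomial.C r * Q) / Polynomial.aeval y Q := by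
        rw [hf, map_sub, _root_.map_mul, Polynomial.aeval_C]
        field_simp
      have hPr : P - Polynomial.C r * Q ≠ 0 := by
        intro h
        rw [h, map_zero, zero_div] at hfr
        exact hfK r (sub_eq_zero.1 hfr).symm
      filter_upwards [eventually_map_div_eval_eq hstab hPr hQ, hstab Q hQ] with a ha haQ
      have hQa : Q.eval a ≠ 0 := by
        intro h
        rw [h, map_zero, zero_sub, w.map_neg] at haQ
        exact haQ.ne rfl
      have h2 : (P - Polynomial.C r * Q).eval a / Q.eval a = P.eval a / Q.eval a - r := by
        simp only [Polynomial.eval_sub, Polynomial.eval_mul, Polynomial.eval_C]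
        field_simp
      rw [← hfr, h2] at ha
      have h3 : algebraMap K L (P.eval a / Q.eval a) - f =
          algebraMap K L (P.eval a / Q.eval a - r) - (f - algebraMap K L r) := by
        rw [map_sub]; ring
      rw [h3, hlog]
      exact (lt_min (ha ▸ h1) h1).trans_le (w.map_sub _ _)
    have hkL : algebraMap K L k ≠ 0 := (_root_.map_ne_zero _).2 hk
    -- The element `k⁻¹ ≻ 1` is used because its logarithmic derivative is `-k†`, and `k† * k = k'`.
    have hkinv := hclose k⁻¹ ((v.inv_neg_iff hk).2 ((hpos k).1 hk0))
    have hstep := eventually_map_div_eval_sub_mul_le hy hstab P Q hQ hk0.le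
    obtain ⟨a, ha1, ha2, ha3⟩ := (hkinv.and (hstep.and (eventually_approx_lt 0))).exists
    obtain ⟨b₀, hb₀⟩ := hyard a (hy0 ▸ ha3.le)
    obtain ⟨b, hb1, hb2⟩ := (ha2.and (eventually_approx_lt b₀)).exists
    have h1 := hb1 (hb₀.trans hb2).le
    rw [← hf] at h1
    obtain ⟨g, hg, h2⟩ := hfar (P.eval b / Q.eval b)
    have hg0 : algebraMap K L g ≠ 0 := (_root_.map_ne_zero _).2 (v.ne_top_iff.1 hg.ne_top)
    have h3 := hL.val_logDeriv_lt_val_deriv hkL hk0 hg0 ((hneg g).2 hg).ne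
    rw [map_inv₀, logDeriv_inv_aux hkL, w.map_neg] at ha1
    rw [← mul_logDeriv_eq_deriv hkL, mul_comm] at h3
    exact ((h1.trans h2).trans_lt h3).not_gt ((w.mul_lt_mul_iff_of_ne_zero hkL).2 ha1)
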